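/- Let $S$ be a $d$-dimensional quantum system with non-degenerate Hamiltonian $H=\sum_{i=1}^d E_i\,|i\rangle\langle i|$, $E_1<\dots<E_d$, and let $|\phi_+\rangle=\frac1{\sqrt d}\sum_{i=1}^d|i\rangle$. The ergotropy of a state $\sigma$ of $S$ is $\mathrm{Erg}(\sigma)=\mathrm{Tr}[H\sigma]-\min_U \mathrm{Tr}[H\,U\sigma U^\dagger]$, with $U$ ranging over all unitaries; $\sigma$ is called passive if $\mathrm{Erg}(\sigma)=0$, and $\mathsf P(S)$ denotes the set of passive states. For positive operators let $D_{\max}(A\|B)=\min\{s\ge 0: A\le 2^sB\}$ ($=\infty$ if there is no such $s$), and put $R^{\rm act}_{\max}(\rho)=\min_{\tau\in\mathsf P(S)}D_{\max}(\rho\|\tau)$. A linear map $\mathcal Q$ on operators on $S$ is called an energy-preserving operation, $\mathcal Q\in\mathsf{EPO}$, if it can be realized by preparing a finite-dimensional auxiliary system $A$ with fully degenerate Hamiltonian $H_A=e\,I_A$ in some state $\sigma$, applying a unitary $U$ on $S\otimes A$ that commutes with $H\otimes I_A+I_S\otimes H_A$, measuring $A$ with a finite-outcome POVM $(M_x)_x$,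 and postselecting a subset $T$ of the outcomes: $$\mathcal Q(X)=\sum_{x\in T}\mathrm{Tr}_A\big[(I_S\otimes M_x)\,U(X\otimes\sigma)U^\dagger\big].$$ Then for every state $\rho$ of $S$ the minimum defining $R^{\rm act}_{\max}(\rho)$ is finite and attained, and $$\max_{\mathcal Q\in\mathsf{EPO}}\ \min_{\tau\in\mathsf P(S)}\ \frac{\langle\phi_+|\mathcal Q(\rho)|\phi_+\rangle}{\langle\phi_+|\mathcal Q(\tau)|\phi_+\rangle}=2^{R^{\rm act}_{\max}(\rho)},$$ where the ratio takes values in $[0,\infty]$ with $c/0=\infty$ for $c>0$ and $0/0=0$, and both the maximum and, for every $\mathcal Q\in\mathsf{EPO}$, the minimum are attained. -/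

import Mathlib

open scoped Matrix Kronecker ComplexOrder ENNReal NNReal

noncomputable section

namespace Activity

/-- Density matrices: positive semidefinite with unit trace. -/
def IsState {n : Type*} [Fintype n] (ρ : Matrix n n ℂ) : Prop :=
  ρ.PosSemidef ∧ ρ.trace = 1

/-- The Hamiltonian `H = ∑ i, E i • |i⟩⟨i|`, as a matrix in its own eigenbasis. All operators on the
system are written as matrices in this basis. -/
def hamiltonian {d : ℕ} (E : Fin d → ℝ) : Matrix (Fin d) (Fin d) ℂ :=
  Matrix.diagonal fun i => (E i : ℂ)

/-- The mean energy `⟨H⟩_ρ = Tr[H ρ]`. -/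
def meanEnergy {d : ℕ} (E : Fin d → ℝ) (ρ : Matrix (Fin d) (Fin d) ℂ) : ℝ :=
  ((hamiltonian E * ρ).trace).re

/-- The ergotropy `⟨H⟩_ρ - min_U ⟨H⟩_{U ρ U†}`, with `U` ranging over all unitaries. -/
def ergotropy {d : ℕ} (E : Fin d → ℝ) (ρ : Matrix (Fin d) (Fin d) ℂ) : ℝ :=
  meanEnergy E ρ -
    ⨅ U : Matrix.unitaryGroup (Fin d) ℂ,
      meanEnergy E ((U : Matrix (Fin d) (Fin d) ℂ) * ρ * (U : Matrix (Fin d) (Fin d) ℂ)ᴴ)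

/-- Passive states: the states of zero ergotropy. -/
def passiveStates {d : ℕ} (E : Fin d → ℝ) : Set (Matrix (Fin d) (Fin d) ℂ) :=
  {τ | IsState τ ∧ ergotropy E τ = 0}

/-- `D_max(A‖B) = min {s ≥ 0 : A ≤ 2 ^ s B}` in the Loewner order, equal to `∞` if there is no
such `s`. -/
def maxRelEntropy {d : ℕ} (A B : Matrix (Fin d) (Fin d) ℂ) : ℝ≥0∞ :=
  ⨅ (s : ℝ≥0) (_ : (((2 : ℝ) ^ (s : ℝ)) • B - A).PosSemidef), (s : ℝ≥0∞)

/-- The max relative entropy of activity: the minimum of `D_max(ρ‖τ)` over passive `τ`. -/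
def maxRelEntropyOfActivity {d : ℕ} (E : Fin d → ℝ) (ρ : Matrix (Fin d) (Fin d) ℂ) : ℝ≥0∞ :=
  ⨅ τ ∈ passiveStates E, maxRelEntropy ρ τ

/-- Partial trace over the second tensor factor. -/
def partialTraceRight {n m : Type*} [Fintype m] (X : Matrix (n × m) (n × m) ℂ) :
    Matrix n n ℂ :=
  Matrix.of fun i j => ∑ a, X (i, a) (j, a)

/-- The Hamiltonian `H ⊗ 1 + 1 ⊗ (e 1)` of the system together with an `m`-dimensional auxiliary
system whose own Hamiltonian `e 1` is fully degenerate. -/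
def totalHamiltonian {d : ℕ} (E : Fin d → ℝ) (m : ℕ) (e : ℝ) :
    Matrix (Fin d × Fin m) (Fin d × Fin m) ℂ :=
  hamiltonian E ⊗ₖ (1 : Matrix (Fin m) (Fin m) ℂ) +
    (1 : Matrix (Fin d) (Fin d) ℂ) ⊗ₖ ((e : ℂ) • (1 : Matrix (Fin m) (Fin m) ℂ))

/-- Energy-preserving operations: prepare an auxiliary system with fully degenerate Hamiltonian in a
state `σ`, let it interact with the system by a unitary `U` that commutes with the total
Hamiltonian, measure the auxiliary system by a positive operator-valued measure `M`, and keep the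
runs whose outcome lies in a subset `T`. Such a map is automatically completely positive and trace
non-increasing. -/
def energyPreservingOperations {d : ℕ} (E : Fin d → ℝ) :
    Set (Matrix (Fin d) (Fin d) ℂ →ₗ[ℂ] Matrix (Fin d) (Fin d) ℂ) :=
  {Q | ∃ (m : ℕ) (e : ℝ) (σ : Matrix (Fin m) (Fin m) ℂ)
        (U : Matrix (Fin d × Fin m) (Fin d × Fin m) ℂ)
        (k : ℕ) (M : Fin k → Matrix (Fin m) (Fin m) ℂ) (T : Finset (Fin k)),
      IsState σ ∧
      U ∈ Matrix.unitaryGroup (Fin d × Fin m) ℂ ∧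
      U * totalHamiltonian E m e = totalHamiltonian E m e * U ∧
      (∀ x, (M x).PosSemidef) ∧ ∑ x, M x = 1 ∧
      ∀ X, Q X = ∑ x ∈ T,
        partialTraceRight (((1 : Matrix (Fin d) (Fin d) ℂ) ⊗ₖ M x) * (U * (X ⊗ₖ σ) * Uᴴ))}

/-- The canonical maximally coherent state `|φ₊⟩ = ∑ i, |i⟩ / √d`. -/
def maxCoherent (d : ℕ) : Fin d → ℂ :=
  fun _ => ((1 / √(d : ℝ) : ℝ) : ℂ)

/-- `⟨φ₊| X |φ₊⟩`. -/
def coherentFidelity {d : ℕ} (X : Matrix (Fin d) (Fin d) ℂ) : ℝ :=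
  (star (maxCoherent d) ⬝ᵥ (X *ᵥ maxCoherent d)).re

/-- `⟨φ₊|Q(ρ)|φ₊⟩ / ⟨φ₊|Q(τ)|φ₊⟩`, in `[0, ∞]`; here `c / 0 = ∞` for `c > 0`, and `0 / 0 = 0`. -/
def fidelityRatio {d : ℕ} (Q : Matrix (Fin d) (Fin d) ℂ →ₗ[ℂ] Matrix (Fin d) (Fin d) ℂ)
    (ρ τ : Matrix (Fin d) (Fin d) ℂ) : ℝ≥0∞ :=
  ENNReal.ofReal (coherentFidelity (Q ρ)) / ENNReal.ofReal (coherentFidelity (Q τ))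

/-- The advantage of `ρ` over the passive states for the operation `Q`. -/
def advantage {d : ℕ} (E : Fin d → ℝ) (ρ : Matrix (Fin d) (Fin d) ℂ)
    (Q : Matrix (Fin d) (Fin d) ℂ →ₗ[ℂ] Matrix (Fin d) (Fin d) ℂ) : ℝ≥0∞ :=
  ⨅ τ ∈ passiveStates E, fidelityRatio Q ρ τ

end Activity

end

/-! The equality is conic duality, and of the passive states it uses only that they form a compact
convex set of states containing the maximally mixed one. Let `s` be the least exponent with `ρ ≤ 2 ^
s τ` for some passive `τ`; compactness provides it (`exists_minimal_dilation`).

Upper bound (`advantage_le`): an energy-preserving operation sends a positive semidefinite matrix to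
one with nonnegative coherent fidelity. Applied to `2 ^ s τ - ρ`, this bounds the ratio at that `τ`
by `2 ^ s`.

Lower bound: by minimality of `s`, no matrix `2 ^ s τ - ρ` is positive definite. Hahn–Banach
separates these matrices from the positive definite ones, and the separating functional is `X ↦ Re ∑
C i j * X i j` with `C` positive semidefinite (`exists_dual_certificate`). Up to the factor `1 / d`,
this is the coherent fidelity of the entrywise product of `C` and `X`. After rescaling, entrywise
multiplication by `C` is itself energy-preserving (`schurMultiplier_mem`), so it reaches `2 ^ s`.

Separation takes place in the real space of all complex matrices, where the positive definite ones
have empty interior. Hence `coerciveMatrices` constrains only the real part of the quadratic form.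
-/

namespace Activity

/-! ### Positive semidefinite matrices, states, and functionals positive on them -/

section PositiveMatrices

variable {n m : Type*} [Fintype n] [Fintype m]

/-- The modulus of a quadratic form is bounded by the sum of the moduli of the entries. -/
theorem norm_dotProduct_mulVec_le (X : Matrix n n ℂ) (x : n → ℂ) :
    ‖star x ⬝ᵥ (X *ᵥ x)‖ ≤ (∑ i, ∑ j, ‖X i j‖) * ∑ k, ‖x k‖ ^ 2 := by
  have hx : ∀ i j, ‖x i‖ * ‖x j‖ ≤ ∑ k, ‖x k‖ ^ 2 := by
    intro i j
    have h : ∀ i, ‖x i‖ ^ 2 ≤ ∑ k, ‖x k‖ ^ 2 := fun i =>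
      Finset.single_le_sum (f := fun k => ‖x k‖ ^ 2) (fun k _ => sq_nonneg _) (Finset.mem_univ i)
    nlinarith [h i, h j, sq_nonneg (‖x i‖ - ‖x j‖)]
  generalize ∑ k, ‖x k‖ ^ 2 = S at hx
  simp only [dotProduct, Matrix.mulVec, Finset.mul_sum, Finset.sum_mul]
  refine (norm_sum_le _ _).trans (Finset.sum_le_sum fun i _ => (norm_sum_le _ _).trans
    (Finset.sum_le_sum fun j _ => ?_))
  calc ‖star x i * (X i j * x j)‖ = ‖X i j‖ * (‖x i‖ * ‖x j‖) := by
        simp [Pi.star_apply]; ring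
    _ ≤ _ := mul_le_mul_of_nonneg_left (hx i j) (norm_nonneg _)

theorem star_dotProduct_self_eq (x : n → ℂ) : star x ⬝ᵥ x = ((∑ k, ‖x k‖ ^ 2 : ℝ) : ℂ) := by
  simp only [dotProduct, Pi.star_apply, RCLike.star_def, Complex.ofReal_sum]
  exact Finset.sum_congr rfl fun k _ => by rw [Complex.conj_mul']; push_cast; rfl

theorem isClosed_posSemidef : IsClosed {X : Matrix n n ℂ | X.PosSemidef} := by
  simp only [Matrix.posSemidef_iff_dotProduct_mulVec, Set.ofPred_and, Set.ofPred_forall]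
  refine IsClosed.inter ?_ (isClosed_iInter fun x => ?_)
  · exact isClosed_eq (by fun_prop) continuous_id
  · exact isClosed_le continuous_const (by fun_prop)

/-- The matrices whose quadratic form has uniformly positive real part. -/
def coerciveMatrices (n : Type*) [Fintype n] : Set (Matrix n n ℂ) :=
  {X | ∃ s > 0, ∀ x : n → ℂ, s * ∑ k, ‖x k‖ ^ 2 ≤ (star x ⬝ᵥ (X *ᵥ x)).re}

/-- A perturbation whose entries have moduli summing to less than `s / 2` changes the form by at
most `s / 2 * ∑ k, ‖x k‖ ^ 2`, so half of the constant survives. -/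
theorem isOpen_coerciveMatrices : IsOpen (coerciveMatrices n) := by
  rw [isOpen_iff_mem_nhds]
  rintro X ⟨s, hs, hX⟩
  have hc : Continuous fun Y : Matrix n n ℂ => ∑ i, ∑ j, ‖(Y - X) i j‖ := by
    simp only [Matrix.sub_apply]
    fun_prop
  have hlt : ∀ᶠ Y in nhds X, ∑ i, ∑ j, ‖(Y - X) i j‖ < s / 2 :=
    hc.continuousAt.eventually_lt continuousAt_const (by simpa using half_pos hs)
  filter_upwards [hlt] with Y hY
  refine ⟨s / 2, half_pos hs, fun x => ?_⟩
  have h0 : 0 ≤ ∑ k, ‖x k‖ ^ 2 := Finset.sum_nonneg fun k _ => sq_nonneg _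
  have h1 := (Complex.abs_re_le_norm _).trans (norm_dotProduct_mulVec_le (Y - X) x)
  have h2 := mul_le_mul_of_nonneg_right hY.le h0
  have h3 := (abs_le.1 (h1.trans h2)).1
  rw [Matrix.sub_mulVec, dotProduct_sub, Complex.sub_re] at h3
  linarith [hX x]

theorem convex_coerciveMatrices : Convex ℝ (coerciveMatrices n) := by
  rintro X ⟨s, hs, hX⟩ Y ⟨t, ht, hY⟩ a b ha hb hab
  refine ⟨a * s + b * t, ?_, fun x => ?_⟩
  · rcases ha.eq_or_lt with rfl | ha
    · simpa [show b = 1 by linarith] using ht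
    · have := mul_pos ha hs
      have := mul_nonneg hb ht.le
      linarith
  · simp only [Matrix.add_mulVec, Matrix.smul_mulVec, dotProduct_add, dotProduct_smul,
      Complex.add_re, Complex.smul_re, smul_eq_mul]
    nlinarith [mul_le_mul_of_nonneg_left (hX x) ha, mul_le_mul_of_nonneg_left (hY x) hb]

theorem smul_one_add_mem_coerciveMatrices [DecidableEq n] {X : Matrix n n ℂ}
    (hX : ∀ x, 0 ≤ (star x ⬝ᵥ (X *ᵥ x)).re) {s : ℝ} (hs : 0 < s) :
    s • (1 : Matrix n n ℂ) + X ∈ coerciveMatrices n := by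
  refine ⟨s, hs, fun x => ?_⟩
  rw [Matrix.add_mulVec, Matrix.smul_mulVec, Matrix.one_mulVec, dotProduct_add, dotProduct_smul,
    star_dotProduct_self_eq, Complex.add_re, Complex.smul_re, Complex.ofReal_re, smul_eq_mul]
  linarith [hX x]

theorem posSemidef_of_mem_coerciveMatrices {X : Matrix n n ℂ} (hX : X.IsHermitian)
    (h : X ∈ coerciveMatrices n) : X.PosSemidef := by
  obtain ⟨s, hs, h⟩ := h
  refine .of_dotProduct_mulVec_nonneg hX fun x => ?_
  have h0 : 0 ≤ s * ∑ k, ‖x k‖ ^ 2 :=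
    mul_nonneg hs.le (Finset.sum_nonneg fun k _ => sq_nonneg _)
  refine Complex.nonneg_iff.2 ⟨h0.trans (h x), ?_⟩
  have := hX.im_star_dotProduct_mulVec_self x
  simpa using this.symm

open scoped MatrixOrder in
theorem exists_eq_conjTranspose_mul_self [DecidableEq n] {X : Matrix n n ℂ} (hX : X.PosSemidef) :
    ∃ B : Matrix n n ℂ, X = Bᴴ * B :=
  CStarAlgebra.nonneg_iff_eq_star_mul_self.mp hX.nonneg

theorem trace_mul_nonneg [DecidableEq n] {A B : Matrix n n ℂ} (hA : A.PosSemidef)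
    (hB : B.PosSemidef) : 0 ≤ (A * B).trace := by
  obtain ⟨K, rfl⟩ := exists_eq_conjTranspose_mul_self hA
  rw [Matrix.mul_assoc, Matrix.trace_mul_comm]
  exact (hB.mul_mul_conjTranspose_same K).trace_nonneg

/-- Writing `X = Bᴴ * B`, unit trace says that the squared moduli of the entries of `B` sum to one.
The bound is crude, but boundedness is all that is needed. -/
theorem norm_apply_le_of_isState {X : Matrix n n ℂ} (hX : IsState X) (i j : n) :
    ‖X i j‖ ≤ Fintype.card n := by
  classical
  obtain ⟨hX, ht⟩ := hX
  obtain ⟨B, rfl⟩ := exists_eq_conjTranspose_mul_self hX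
  have hsum : ∑ i, ∑ k, ‖B k i‖ ^ 2 = 1 := by
    have : ((∑ i, ∑ k, ‖B k i‖ ^ 2 : ℝ) : ℂ) = 1 := by
      rw [← ht]
      simp only [Matrix.trace, Matrix.diag, Matrix.mul_apply, Matrix.conjTranspose_apply,
        RCLike.star_def, Complex.ofReal_sum]
      refine Finset.sum_congr rfl fun i _ => Finset.sum_congr rfl fun k _ => ?_
      rw [Complex.conj_mul']; push_cast; rfl
    exact_mod_cast this
  have hB : ∀ k i, ‖B k i‖ ≤ 1 := by
    intro k i
    have h1 : ‖B k i‖ ^ 2 ≤ ∑ k, ‖B k i‖ ^ 2 :=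
      Finset.single_le_sum (f := fun k => ‖B k i‖ ^ 2) (fun k _ => sq_nonneg _) (Finset.mem_univ k)
    have h2 : ∑ k, ‖B k i‖ ^ 2 ≤ ∑ i, ∑ k, ‖B k i‖ ^ 2 :=
      Finset.single_le_sum (f := fun i => ∑ k, ‖B k i‖ ^ 2)
        (fun i _ => Finset.sum_nonneg fun k _ => sq_nonneg _) (Finset.mem_univ i)
    nlinarith [norm_nonneg (B k i)]
  rw [Matrix.mul_apply]
  refine (norm_sum_le _ _).trans ?_
  calc ∑ k, ‖Bᴴ i k * B k j‖ ≤ ∑ _k : n, (1 : ℝ) := Finset.sum_le_sum fun k _ => by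
        rw [norm_mul, Matrix.conjTranspose_apply, norm_star]
        exact mul_le_one₀ (hB k i) (norm_nonneg _) (hB k j)
    _ = _ := by simp

theorem isClosed_isState : IsClosed {X : Matrix n n ℂ | IsState X} :=
  isClosed_posSemidef.inter (isClosed_eq (by fun_prop) continuous_const)

theorem isCompact_isState : IsCompact {X : Matrix n n ℂ | IsState X} := by
  have hK : @IsCompact (Matrix n n ℂ) _ _ := isCompact_univ_pi (X := fun _ : n => n → ℂ)
    (fun _ => isCompact_univ_pi
      (fun _ : n => isCompact_closedBall (0 : ℂ) (Fintype.card n : ℝ)))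
  exact hK.of_isClosed_subset isClosed_isState fun X hX i _ j _ => by
    simpa using norm_apply_le_of_isState hX i j

theorem convex_isState : Convex ℝ {X : Matrix n n ℂ | IsState X} := by
  rintro X ⟨hX, hX'⟩ Y ⟨hY, hY'⟩ a b ha hb hab
  refine ⟨(hX.smul ha).add (hY.smul hb), ?_⟩
  rw [Matrix.trace_add, Matrix.trace_smul, Matrix.trace_smul, hX', hY', ← add_smul, hab, one_smul]

theorem IsState.conj_unitary [DecidableEq n] {X U : Matrix n n ℂ} (hX : IsState X)
    (hU : U ∈ Matrix.unitaryGroup n ℂ) : IsState (U * X * Uᴴ) := by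
  refine ⟨hX.1.mul_mul_conjTranspose_same U, ?_⟩
  rw [Matrix.mul_assoc, Matrix.trace_mul_comm, Matrix.mul_assoc, ← Matrix.star_eq_conjTranspose,
    Matrix.mem_unitaryGroup_iff'.1 hU, Matrix.mul_one, hX.2]

/-- A real functional that is bounded below on the coercive matrices is, up to the passage to the
real part, the pairing with a positive semidefinite matrix. -/
theorem exists_posSemidef_of_bounded_below [DecidableEq n] (f : Matrix n n ℂ →ₗ[ℝ] ℝ) (c : ℝ)
    (hf : ∀ X ∈ coerciveMatrices n, c < f X) :
    ∃ C : Matrix n n ℂ, C.PosSemidef ∧ ∀ X, f X = (∑ i, ∑ j, C i j * X i j).re := by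
  -- If `f X < 0`, the coercive matrices `1 + k • X` would drive `f` below `c` as `k` grows.
  have hnn : ∀ X : Matrix n n ℂ, (∀ x, 0 ≤ (star x ⬝ᵥ (X *ᵥ x)).re) → 0 ≤ f X := by
    intro X hX
    by_contra! hlt
    obtain ⟨k, hk⟩ := exists_nat_gt ((f 1 - c) / (-f X))
    rw [div_lt_iff₀ (by linarith)] at hk
    have hkX : ∀ x, 0 ≤ (star x ⬝ᵥ (((k : ℝ) • X) *ᵥ x)).re := fun x => by
      rw [Matrix.smul_mulVec, dotProduct_smul, Complex.smul_re]
      exact smul_nonneg k.cast_nonneg (hX x)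
    have := hf _ (smul_one_add_mem_coerciveMatrices hkX one_pos)
    simp only [map_add, map_smul, smul_eq_mul, one_mul] at this
    linarith
  -- The form of `I • X` has zero real part, so `hnn` applies to both signs. Thus the complex
  -- extension `F` of `f` is real on Hermitian matrices.
  have him : ∀ X : Matrix n n ℂ, X.IsHermitian → f (Complex.I • X) = 0 := by
    intro X hX
    have hq : ∀ x, (star x ⬝ᵥ ((Complex.I • X) *ᵥ x)).re = 0 := fun x => by
      rw [Matrix.smul_mulVec, dotProduct_smul, smul_eq_mul, Complex.I_mul_re]
      have := hX.im_star_dotProduct_mulVec_self x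
      simpa using this
    have h1 := hnn _ fun x => (hq x).ge
    have h2 := hnn (-(Complex.I • X)) fun x => by
      rw [Matrix.neg_mulVec, dotProduct_neg, Complex.neg_re, hq, neg_zero]
    rw [map_neg] at h2
    linarith
  let F : Matrix n n ℂ →ₗ[ℂ] ℂ := Module.Dual.extendRCLike (𝕜 := ℂ) f
  have hFre : ∀ X, (F X).re = f X := fun X => Module.Dual.re_extendRCLike_apply (𝕜 := ℂ) f X
  have hFim : ∀ X : Matrix n n ℂ, X.IsHermitian → (F X).im = 0 := fun X hX => by
    have := Module.Dual.im_extendRCLike_apply (𝕜 := ℂ) f X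
    simp only [RCLike.im_to_complex] at this
    rw [show (F X).im = _ from this]
    simpa using him X hX
  have hF : ∀ X : Matrix n n ℂ, F X = ∑ i, ∑ j, F (Matrix.single i j 1) * X i j := by
    intro X
    conv_lhs => rw [Matrix.matrix_eq_sum_single X]
    simp only [map_sum]
    refine Finset.sum_congr rfl fun i _ => Finset.sum_congr rfl fun j _ => ?_
    rw [show Matrix.single i j (X i j) = X i j • Matrix.single i j (1 : ℂ) by simp, map_smul,
      smul_eq_mul, mul_comm]
  refine ⟨Matrix.of fun i j => F (Matrix.single i j 1), ?_, fun X => by rw [← hFre, hF]; rfl⟩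
  refine .of_dotProduct_mulVec_nonneg ?_ fun x => ?_
  · ext i j
    -- These two Hermitian combinations of matrix units give the imaginary and the real part of `C j
    -- i = star (C i j)`.
    have h1 := hFim (Matrix.single i j 1 + Matrix.single j i 1) (by
      rw [Matrix.IsHermitian, Matrix.conjTranspose_add, Matrix.conjTranspose_single,
        Matrix.conjTranspose_single, star_one, add_comm])
    have h2 := hFim (Complex.I • (Matrix.single i j 1 - Matrix.single j i 1)) (by
      rw [Matrix.IsHermitian, Matrix.conjTranspose_smul, Matrix.conjTranspose_sub,
        Matrix.conjTranspose_single, Matrix.conjTranspose_single, star_one, RCLike.star_def,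
        Complex.conj_I, neg_smul, ← smul_neg, neg_sub])
    rw [map_add, Complex.add_im] at h1
    rw [map_smul, smul_eq_mul, map_sub, Complex.I_mul_im, Complex.sub_re] at h2
    rw [Matrix.conjTranspose_apply, Matrix.of_apply, Matrix.of_apply]
    apply Complex.ext
    · simp; linarith
    · simp; linarith
  -- The pairing involves no transpose, so the form of `C` at `x` is `F` at the conjugated rank-one
  -- matrix.
  · have hP := Matrix.posSemidef_vecMulVec_star_self x
    have hval : F (Matrix.vecMulVec (star x) x) =
        star x ⬝ᵥ ((Matrix.of fun i j => F (Matrix.single i j 1)) *ᵥ x) := by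
      rw [hF]
      simp only [dotProduct, Matrix.mulVec, Matrix.vecMulVec_apply, Matrix.of_apply,
        Finset.mul_sum]
      exact Finset.sum_congr rfl fun i _ => Finset.sum_congr rfl fun j _ => by ring
    rw [← hval]
    refine Complex.nonneg_iff.2 ⟨?_, (hFim _ hP.1).symm⟩
    rw [hFre]
    exact hnn _ fun y => (Complex.nonneg_iff.1 (hP.dotProduct_mulVec_nonneg y)).1

end PositiveMatrices

end Activity

namespace Activity

/-! ### Passive states, the optimal dilation and its dual certificate -/

section PassiveStates

variable {d : ℕ} (E : Fin d → ℝ)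

theorem meanEnergy_eq_sum (X : Matrix (Fin d) (Fin d) ℂ) :
    meanEnergy E X = ∑ i, E i * (X i i).re := by
  simp [meanEnergy, hamiltonian, Matrix.trace, Matrix.diagonal_mul]

/-- Makes the real infimum in `ergotropy` a genuine one rather than the default value `0`. -/
theorem bddBelow_meanEnergy_unitary {τ : Matrix (Fin d) (Fin d) ℂ} (hτ : IsState τ) :
    BddBelow (Set.range fun U : Matrix.unitaryGroup (Fin d) ℂ =>
      meanEnergy E ((U : Matrix (Fin d) (Fin d) ℂ) * τ * (U : Matrix (Fin d) (Fin d) ℂ)ᴴ)) := by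
  refine ⟨∑ i, -(|E i| * d), ?_⟩
  rintro _ ⟨U, rfl⟩
  simp only [meanEnergy_eq_sum]
  refine Finset.sum_le_sum fun i _ => ?_
  refine (abs_le.1 ?_).1
  rw [abs_mul]
  refine mul_le_mul_of_nonneg_left ((Complex.abs_re_le_norm _).trans ?_) (abs_nonneg _)
  simpa using norm_apply_le_of_isState (hτ.conj_unitary U.2) i i

/-- A state is passive iff no unitary lowers its mean energy. -/
theorem mem_passiveStates_iff {τ : Matrix (Fin d) (Fin d) ℂ} :
    τ ∈ passiveStates E ↔ IsState τ ∧ ∀ U : Matrix.unitaryGroup (Fin d) ℂ,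
      meanEnergy E τ ≤
        meanEnergy E ((U : Matrix (Fin d) (Fin d) ℂ) * τ * (U : Matrix (Fin d) (Fin d) ℂ)ᴴ) := by
  refine and_congr_right fun hτ => ?_
  have hb := bddBelow_meanEnergy_unitary E hτ
  rw [ergotropy, sub_eq_zero]
  constructor
  · intro h U
    rw [h]
    exact ciInf_le hb U
  · intro h
    refine le_antisymm (le_ciInf h) ((ciInf_le hb 1).trans_eq ?_)
    simp

/-- For each fixed unitary, the condition in `mem_passiveStates_iff` is a linear inequality in the
state. -/
theorem convex_passiveStates : Convex ℝ (passiveStates E) := by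
  intro X hX Y hY a b ha hb hab
  rw [mem_passiveStates_iff] at *
  refine ⟨convex_isState hX.1 hY.1 ha hb hab, fun U => ?_⟩
  have hlin : ∀ Z W : Matrix (Fin d) (Fin d) ℂ,
      meanEnergy E (a • Z + b • W) = a * meanEnergy E Z + b * meanEnergy E W := by
    intro Z W
    simp [meanEnergy, Matrix.mul_add, Matrix.trace_add]
  rw [Matrix.mul_add, Matrix.add_mul, Matrix.mul_smul, Matrix.mul_smul, Matrix.smul_mul,
    Matrix.smul_mul, hlin, hlin]
  exact add_le_add (mul_le_mul_of_nonneg_left (hX.2 U) ha) (mul_le_mul_of_nonneg_left (hY.2 U) hb)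

theorem isCompact_passiveStates : IsCompact (passiveStates E) := by
  have hm : Continuous (meanEnergy E) := by
    unfold meanEnergy
    fun_prop
  refine isCompact_isState.of_isClosed_subset ?_ fun τ hτ => hτ.1
  have : passiveStates E = {τ | IsState τ} ∩ ⋂ U : Matrix.unitaryGroup (Fin d) ℂ,
      {τ | meanEnergy E τ ≤
        meanEnergy E ((U : Matrix (Fin d) (Fin d) ℂ) * τ *
          (U : Matrix (Fin d) (Fin d) ℂ)ᴴ)} := by
    ext τ
    simp [mem_passiveStates_iff]
  rw [this]
  exact isClosed_isState.inter (isClosed_iInter fun U =>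
    isClosed_le hm (hm.comp (by fun_prop)))

theorem maximallyMixed_mem_passiveStates (hd : d ≠ 0) :
    ((d : ℝ)⁻¹ • (1 : Matrix (Fin d) (Fin d) ℂ)) ∈ passiveStates E := by
  have hd' : (d : ℝ) ≠ 0 := Nat.cast_ne_zero.2 hd
  rw [mem_passiveStates_iff]
  refine ⟨⟨Matrix.PosSemidef.one.smul (by positivity), ?_⟩, fun U => ?_⟩
  · rw [Matrix.trace_smul, Matrix.trace_one, Fintype.card_fin, Complex.real_smul]
    push_cast
    exact inv_mul_cancel₀ (Nat.cast_ne_zero.2 hd)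
  · rw [Matrix.mul_smul, Matrix.smul_mul, Matrix.mul_one, ← Matrix.star_eq_conjTranspose,
      Matrix.mem_unitaryGroup_iff.1 U.2]

theorem IsState.dim_ne_zero {ρ : Matrix (Fin d) (Fin d) ℂ} (hρ : IsState ρ) : d ≠ 0 := by
  rintro rfl
  simpa [Matrix.trace] using hρ.2

/-- The optimal dilation: a smallest `s ≥ 0` such that `ρ ≤ 2 ^ s τ` for some passive `τ`. -/
theorem exists_minimal_dilation {ρ : Matrix (Fin d) (Fin d) ℂ} (hρ : IsState ρ) :
    ∃ (s : ℝ≥0) (τ : Matrix (Fin d) (Fin d) ℂ), τ ∈ passiveStates E ∧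
      ((2 : ℝ) ^ (s : ℝ) • τ - ρ).PosSemidef ∧
      ∀ (t : ℝ≥0), ∀ τ' ∈ passiveStates E, ((2 : ℝ) ^ (t : ℝ) • τ' - ρ).PosSemidef → s ≤ t := by
  have hd := hρ.dim_ne_zero
  have hd1 : (1 : ℝ) ≤ d := by exact_mod_cast Nat.one_le_iff_ne_zero.2 hd
  set c : ℝ := ∑ i, ∑ j, ‖ρ i j‖ with hc
  have hc0 : 0 ≤ c := by positivity
  have hdom : ∀ r : ℝ, c ≤ r → (r • (1 : Matrix (Fin d) (Fin d) ℂ) - ρ).PosSemidef := by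
    intro r hr
    have hH : (r • (1 : Matrix (Fin d) (Fin d) ℂ)).IsHermitian := by
      rw [Matrix.IsHermitian, Matrix.conjTranspose_smul, Matrix.conjTranspose_one]
      simp
    have hH' := hH.sub hρ.1.1
    refine .of_dotProduct_mulVec_nonneg hH' fun x => Complex.nonneg_iff.2 ⟨?_, ?_⟩
    · rw [Matrix.sub_mulVec, Matrix.smul_mulVec, Matrix.one_mulVec, dotProduct_sub,
        dotProduct_smul, star_dotProduct_self_eq, Complex.sub_re, Complex.smul_re,
        Complex.ofReal_re, smul_eq_mul]
      have h1 := (Complex.re_le_norm _).trans (norm_dotProduct_mulVec_le ρ x)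
      have h2 : 0 ≤ ∑ k, ‖x k‖ ^ 2 := by positivity
      have h3 := mul_le_mul_of_nonneg_right hr h2
      linarith
    · have := hH'.im_star_dotProduct_mulVec_self x
      simpa using this.symm
  -- The witness makes the right side `1 + c`; the extra `1` keeps the logarithm nonnegative. By
  -- `hdom`, the maximally mixed state is then feasible at `s₀`, so the search can be confined to
  -- the compact range `[0, s₀]`.
  obtain ⟨s₀, hs₀⟩ : ∃ s₀ : ℝ≥0, c ≤ (2 : ℝ) ^ (s₀ : ℝ) * (d : ℝ)⁻¹ := by
    refine ⟨.mk (Real.logb 2 ((1 + c) * d)) (Real.logb_nonneg one_lt_two (by nlinarith)), ?_⟩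
    rw [NNReal.coe_mk, Real.rpow_logb two_pos (by norm_num) (by positivity),
      mul_inv_cancel_right₀ (by positivity)]
    linarith
  let K : Set (ℝ≥0 × Matrix (Fin d) (Fin d) ℂ) :=
    (Set.Icc 0 s₀ ×ˢ passiveStates E) ∩ {p | ((2 : ℝ) ^ (p.1 : ℝ) • p.2 - ρ).PosSemidef}
  have hmem : (s₀, (d : ℝ)⁻¹ • (1 : Matrix (Fin d) (Fin d) ℂ)) ∈ K := by
    refine ⟨⟨⟨zero_le, le_rfl⟩, maximallyMixed_mem_passiveStates E hd⟩, ?_⟩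
    have := hdom _ hs₀
    rwa [mul_smul] at this
  have hcont : Continuous fun p : ℝ≥0 × Matrix (Fin d) (Fin d) ℂ =>
      (2 : ℝ) ^ (p.1 : ℝ) • p.2 - ρ := by
    have : Continuous fun p : ℝ≥0 × Matrix (Fin d) (Fin d) ℂ => (2 : ℝ) ^ (p.1 : ℝ) :=
      (Real.continuous_const_rpow two_ne_zero).comp (by fun_prop)
    fun_prop
  have hK : IsCompact K := (isCompact_Icc.prod (isCompact_passiveStates E)).inter_right
    (isClosed_posSemidef.preimage hcont)
  obtain ⟨⟨s, τ⟩, hsτ, hmin⟩ := hK.exists_isMinOn ⟨_, hmem⟩ continuous_fst.continuousOn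
  refine ⟨s, τ, hsτ.1.2, hsτ.2, fun t τ' hτ' ht => ?_⟩
  rcases le_total t s₀ with h | h
  · exact hmin (show (t, τ') ∈ K from ⟨⟨⟨zero_le, h⟩, hτ'⟩, ht⟩)
  · exact hsτ.1.1.2.trans h

/-- Dual certificate: a positive semidefinite `C` whose pairing with `ρ` is positive and exceeds
the pairing with any passive state by at least the factor `2 ^ s`. -/
theorem exists_dual_certificate {ρ : Matrix (Fin d) (Fin d) ℂ} (hρ : IsState ρ) (s : ℝ≥0)
    (hs : ∀ (t : ℝ≥0), ∀ τ ∈ passiveStates E, ((2 : ℝ) ^ (t : ℝ) • τ - ρ).PosSemidef → s ≤ t) :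
    ∃ C : Matrix (Fin d) (Fin d) ℂ, C.PosSemidef ∧ 0 < (∑ i, ∑ j, C i j * ρ i j).re ∧
      ∀ τ ∈ passiveStates E,
        (2 : ℝ) ^ (s : ℝ) * (∑ i, ∑ j, C i j * τ i j).re ≤ (∑ i, ∑ j, C i j * ρ i j).re := by
  have hd := hρ.dim_ne_zero
  set l : ℝ := (2 : ℝ) ^ (s : ℝ) with hl
  have hl0 : 0 < l := Real.rpow_pos_of_pos two_pos _
  have hconv : Convex ℝ ((fun τ => l • τ - ρ) '' passiveStates E) := by
    rintro _ ⟨X, hX, rfl⟩ _ ⟨Y, hY, rfl⟩ a b ha hb hab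
    refine ⟨a • X + b • Y, convex_passiveStates E hX hY ha hb hab, ?_⟩
    have : ρ = a • ρ + b • ρ := by rw [← add_smul, hab, one_smul]
    simp only [smul_sub, smul_add, smul_comm l]
    nth_rw 1 [this]
    abel
  -- By openness, a coercive `l • τ - ρ` would stay coercive for some `r < l`, contradicting
  -- minimality of `s`. Comparing traces gives `1 ≤ r`, so `logb 2 r` is an admissible exponent.
  have hdisj : Disjoint (coerciveMatrices (Fin d)) ((fun τ => l • τ - ρ) '' passiveStates E) := by
    rw [Set.disjoint_left]
    rintro _ hX ⟨τ, hτ, rfl⟩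
    have hcont : Continuous fun r : ℝ => r • τ - ρ := by fun_prop
    have hev : ∀ᶠ r in nhds l, r • τ - ρ ∈ coerciveMatrices (Fin d) :=
      hcont.continuousAt.eventually_mem (isOpen_coerciveMatrices.mem_nhds hX)
    obtain ⟨r, hr, hrl⟩ := ((hev.filter_mono nhdsWithin_le_nhds).and
      (self_mem_nhdsWithin : Set.Iio l ∈ nhdsWithin l (Set.Iio l))).exists
    have hrl : r < l := hrl
    have hH : (r • τ - ρ).IsHermitian := by
      refine Matrix.IsHermitian.sub ?_ hρ.1.1
      rw [Matrix.IsHermitian, Matrix.conjTranspose_smul, hτ.1.1.1.eq]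
      simp
    have hP := posSemidef_of_mem_coerciveMatrices hH hr
    have hr1 : 1 ≤ r := by
      have := hP.trace_nonneg
      rw [Matrix.trace_sub, Matrix.trace_smul, hτ.1.2, hρ.2, Complex.real_smul, mul_one,
        sub_nonneg] at this
      exact_mod_cast this
    have hle := hs (.mk (Real.logb 2 r) (Real.logb_nonneg one_lt_two hr1)) τ hτ (by
      rwa [NNReal.coe_mk, Real.rpow_logb two_pos (by norm_num) (by linarith)])
    have hle' : (s : ℝ) ≤ Real.logb 2 r := hle
    rw [Real.le_logb_iff_rpow_le one_lt_two (by linarith)] at hle'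
    linarith
  obtain ⟨g, u, hg, hu⟩ := geometric_hahn_banach_open convex_coerciveMatrices
    isOpen_coerciveMatrices hconv hdisj
  obtain ⟨C, hC, hfC⟩ := exists_posSemidef_of_bounded_below (-g.toLinearMap) (-u)
    fun X hX => by simpa using hg X hX
  refine ⟨C, hC, ?_⟩
  simp only [← hfC]
  set f : Matrix (Fin d) (Fin d) ℂ →ₗ[ℝ] ℝ := -g.toLinearMap with hf
  have hfu : ∀ X ∈ coerciveMatrices (Fin d), -u < f X := fun X hX => by simpa [hf] using hg X hX
  have hfρ : ∀ τ ∈ passiveStates E, l * f τ + u ≤ f ρ := by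
    intro τ hτ
    have : u ≤ g (l • τ - ρ) := hu _ ⟨τ, hτ, rfl⟩
    rw [map_sub, map_smul, smul_eq_mul] at this
    simp only [hf, LinearMap.neg_apply, ContinuousLinearMap.coe_coe]
    linarith
  have hone : ∀ r : ℝ, 0 < r → r • (1 : Matrix (Fin d) (Fin d) ℂ) ∈ coerciveMatrices (Fin d) :=
    fun r hr => by simpa using smul_one_add_mem_coerciveMatrices (n := Fin d) (X := 0) (by simp) hr
  -- The matrices `r • 1` with `r > 0` are all coercive: small `r` forces `0 ≤ u`, large `r` forces
  -- `0 ≤ f 1`.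
  have hu0 : 0 ≤ u := by
    by_contra! hlt
    have hpos : 0 < f 1 := by
      have := hfu _ (hone 1 one_pos)
      rw [one_smul] at this
      linarith
    have := hfu _ (hone (-u / f 1) (div_pos (by linarith) hpos))
    rw [map_smul, smul_eq_mul, div_mul_cancel₀ _ hpos.ne'] at this
    exact lt_irrefl _ this
  have hf1 : 0 ≤ f 1 := by
    by_contra! hlt
    have h := hfu _ (hone ((u + 1) / -f 1) (div_pos (by linarith) (by linarith)))
    rw [map_smul, smul_eq_mul, div_mul_eq_mul_div, lt_div_iff₀ (by linarith)] at h
    nlinarith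
  refine ⟨?_, fun τ hτ => by linarith [hfρ τ hτ]⟩
  -- At the maximally mixed state this reads `l * (d⁻¹ * f 1) + u ≤ f ρ`. Both terms are
  -- nonnegative, and `u = 0` forces `0 < f 1`, so `f ρ` is strictly positive.
  have hmix := hfρ _ (maximallyMixed_mem_passiveStates E hd)
  rw [map_smul, smul_eq_mul] at hmix
  have hdpos : 0 < (d : ℝ)⁻¹ := by positivity
  rcases hu0.eq_or_lt with h0 | h0
  · have : 0 < f 1 := by
      have := hfu _ (hone 1 one_pos)
      rw [one_smul] at this
      linarith
    have := mul_pos hl0 (mul_pos hdpos this)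
    linarith
  · have := mul_nonneg hl0.le (mul_nonneg hdpos.le hf1)
    linarith

end PassiveStates

end Activity

namespace Activity

/-! ### Energy-preserving operations and Schur multipliers -/

section Operations

/-- Exhibits the fidelity of one measurement outcome as a trace of a product, nonnegative when both
factors are positive semidefinite. -/
theorem star_dotProduct_partialTraceRight_mulVec {n m : Type*} [Fintype n] [DecidableEq n]
    [Fintype m] (M : Matrix m m ℂ) (Y : Matrix (n × m) (n × m) ℂ) (v : n → ℂ) :
    star v ⬝ᵥ (partialTraceRight (((1 : Matrix n n ℂ) ⊗ₖ M) * Y) *ᵥ v) =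
      ((Matrix.vecMulVec v (star v) ⊗ₖ M) * Y).trace := by
  simp only [dotProduct, Matrix.mulVec, partialTraceRight, Matrix.of_apply, Matrix.mul_apply,
    Matrix.trace, Matrix.diag, Matrix.kroneckerMap_apply, Fintype.sum_prod_type, Matrix.one_apply,
    ite_mul, one_mul, zero_mul, Matrix.vecMulVec_apply, Finset.sum_mul, Finset.mul_sum,
    Finset.sum_ite_irrel, Finset.sum_const_zero, Finset.sum_ite_eq, Finset.mem_univ, if_true]
  rw [Finset.sum_comm]
  refine Finset.sum_congr rfl fun j _ => ?_
  rw [Finset.sum_comm]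
  exact Finset.sum_congr rfl fun a _ => Finset.sum_congr rfl fun i _ =>
    Finset.sum_congr rfl fun b _ => by ring

variable {d : ℕ}

theorem coherentFidelity_add (X Y : Matrix (Fin d) (Fin d) ℂ) :
    coherentFidelity (X + Y) = coherentFidelity X + coherentFidelity Y := by
  simp [coherentFidelity, Matrix.add_mulVec, dotProduct_add]

theorem coherentFidelity_sub (X Y : Matrix (Fin d) (Fin d) ℂ) :
    coherentFidelity (X - Y) = coherentFidelity X - coherentFidelity Y := by
  simp [coherentFidelity, Matrix.sub_mulVec, dotProduct_sub]

theorem coherentFidelity_smul (r : ℝ) (X : Matrix (Fin d) (Fin d) ℂ) :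
    coherentFidelity (r • X) = r * coherentFidelity X := by
  simp [coherentFidelity, Matrix.smul_mulVec, dotProduct_smul]

theorem continuous_coherentFidelity : Continuous (coherentFidelity (d := d)) := by
  unfold coherentFidelity
  fun_prop

theorem coherentFidelity_eq_sum (X : Matrix (Fin d) (Fin d) ℂ) :
    coherentFidelity X = (d : ℝ)⁻¹ * (∑ i, ∑ j, X i j).re := by
  have h : (1 / √(d : ℝ)) * (1 / √(d : ℝ)) = (d : ℝ)⁻¹ := by
    rw [div_mul_div_comm, Real.mul_self_sqrt d.cast_nonneg, one_mul, one_div]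
  have hX : star (maxCoherent d) ⬝ᵥ (X *ᵥ maxCoherent d) =
      (((d : ℝ)⁻¹ : ℝ) : ℂ) * ∑ i, ∑ j, X i j := by
    simp only [dotProduct, Matrix.mulVec, maxCoherent, Pi.star_apply, RCLike.star_def,
      Complex.conj_ofReal, ← Finset.sum_mul, Finset.mul_sum, ← h, Complex.ofReal_mul]
    refine Finset.sum_congr rfl fun i _ => ?_
    rw [← Finset.mul_sum]
    ring
  rw [coherentFidelity, hX, Complex.re_ofReal_mul]

variable {E : Fin d → ℝ}

theorem coherentFidelity_nonneg_of_mem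
    {Q : Matrix (Fin d) (Fin d) ℂ →ₗ[ℂ] Matrix (Fin d) (Fin d) ℂ}
    (hQ : Q ∈ energyPreservingOperations E) {X : Matrix (Fin d) (Fin d) ℂ} (hX : X.PosSemidef) :
    0 ≤ coherentFidelity (Q X) := by
  obtain ⟨m, e, σ, U, k, M, T, hσ, -, -, hM, -, hQ⟩ := hQ
  have hlin : coherentFidelity (Q X) = ∑ x ∈ T, coherentFidelity
      (partialTraceRight (((1 : Matrix (Fin d) (Fin d) ℂ) ⊗ₖ M x) * (U * (X ⊗ₖ σ) * Uᴴ))) := by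
    rw [hQ]
    exact map_sum (AddMonoidHom.mk' coherentFidelity coherentFidelity_add) _ _
  rw [hlin]
  refine Finset.sum_nonneg fun x _ => ?_
  rw [coherentFidelity, star_dotProduct_partialTraceRight_mulVec]
  exact (Complex.nonneg_iff.1 (trace_mul_nonneg
    ((Matrix.posSemidef_vecMulVec_self_star _).kronecker (hM x))
    ((hX.kronecker hσ.1).mul_mul_conjTranspose_same U))).1

/-- Every unit vector is the first column of a unitary matrix. -/
theorem exists_unitary_first_column {m : ℕ} (v : Fin (m + 1) → ℂ) (hv : ∑ a, ‖v a‖ ^ 2 = 1) :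
    ∃ V ∈ Matrix.unitaryGroup (Fin (m + 1)) ℂ, ∀ a, V a 0 = v a := by
  let w : EuclideanSpace ℂ (Fin (m + 1)) := WithLp.toLp 2 v
  have hw : ‖w‖ = 1 := by
    rw [EuclideanSpace.norm_eq, Real.sqrt_eq_one]
    exact hv
  have hon : Orthonormal ℂ (({0} : Set (Fin (m + 1))).domRestrict fun _ => w) := by
    refine ⟨fun _ => hw, fun i j hij => (hij (Subsingleton.elim i j)).elim⟩
  obtain ⟨b, hb⟩ := hon.exists_orthonormalBasis_extension_of_card_eq (by simp)
  refine ⟨_, (EuclideanSpace.basisFun (Fin (m + 1)) ℂ).toMatrix_orthonormalBasis_mem_unitary b,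
    fun a => ?_⟩
  simp [Module.Basis.toMatrix_apply, hb 0 rfl, w]

/-- The unitary `∑ i, |i⟩⟨i| ⊗ V i`. -/
def controlled {m : ℕ} (V : Fin d → Matrix (Fin m) (Fin m) ℂ) :
    Matrix (Fin d × Fin m) (Fin d × Fin m) ℂ :=
  (Matrix.blockDiagonal V).submatrix (Equiv.prodComm _ _) (Equiv.prodComm _ _)

theorem controlled_apply {m : ℕ} (V : Fin d → Matrix (Fin m) (Fin m) ℂ) (i j : Fin d)
    (a b : Fin m) : controlled V (i, a) (j, b) = if i = j then V i a b else 0 := by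
  simp [controlled, Matrix.blockDiagonal_apply]

theorem controlled_mem_unitaryGroup {m : ℕ} {V : Fin d → Matrix (Fin m) (Fin m) ℂ}
    (hV : ∀ i, V i ∈ Matrix.unitaryGroup (Fin m) ℂ) :
    controlled V ∈ Matrix.unitaryGroup (Fin d × Fin m) ℂ := by
  rw [Matrix.mem_unitaryGroup_iff, controlled, Matrix.star_eq_conjTranspose,
    Matrix.conjTranspose_submatrix, Matrix.submatrix_mul_equiv, Matrix.blockDiagonal_conjTranspose,
    ← Matrix.blockDiagonal_mul]
  have : (fun i => V i * (V i)ᴴ) = 1 := funext fun i => Matrix.mem_unitaryGroup_iff.1 (hV i)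
  rw [this, Matrix.blockDiagonal_one, Matrix.submatrix_one_equiv]

/-- The total Hamiltonian is diagonal with entries depending only on the system index, which
`controlled V` never changes. -/
theorem controlled_mul_totalHamiltonian {m : ℕ} (V : Fin d → Matrix (Fin m) (Fin m) ℂ)
    (E : Fin d → ℝ) (e : ℝ) :
    controlled V * totalHamiltonian E m e = totalHamiltonian E m e * controlled V := by
  have : totalHamiltonian E m e = Matrix.diagonal fun p => ((E p.1 : ℂ) + e) := by
    ext ⟨i, a⟩ ⟨j, b⟩
    simp only [totalHamiltonian, hamiltonian, Matrix.add_apply, Matrix.kroneckerMap_apply,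
      Matrix.diagonal_apply, Matrix.one_apply, Matrix.smul_apply, Prod.mk.injEq, smul_eq_mul]
    by_cases hi : i = j <;> by_cases ha : a = b <;> simp [hi, ha]
  rw [this]
  ext ⟨i, a⟩ ⟨j, b⟩
  rw [Matrix.mul_diagonal, Matrix.diagonal_mul, controlled_apply]
  split_ifs with h
  · subst h; ring
  · simp

/-- The auxiliary system starts in its basis vector `0`, so only column `0` of each `V i` matters.
-/
theorem controlled_conj_apply {m : ℕ} (V : Fin d → Matrix (Fin (m + 1)) (Fin (m + 1)) ℂ)
    (X : Matrix (Fin d) (Fin d) ℂ) (i j : Fin d) (a b : Fin (m + 1)) :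
    (controlled V * (X ⊗ₖ Matrix.single 0 0 1) * (controlled V)ᴴ :
      Matrix (Fin d × Fin (m + 1)) (Fin d × Fin (m + 1)) ℂ) (i, a) (j, b) =
      X i j * (V i a 0 * star (V j b 0)) := by
  have h1 : ∀ k c, (controlled V * (X ⊗ₖ Matrix.single 0 0 1) :
      Matrix (Fin d × Fin (m + 1)) (Fin d × Fin (m + 1)) ℂ) (i, a) (k, c) =
      if c = 0 then V i a 0 * X i k else 0 := by
    intro k c
    rw [Matrix.mul_apply, Fintype.sum_prod_type, Finset.sum_eq_single i
      (fun l _ hl => by simp [controlled_apply, hl.symm]) (by simp), Finset.sum_eq_single 0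
      (fun l _ hl => by simp [hl.symm]) (by simp)]
    by_cases hc : c = 0
    · simp [hc, controlled_apply]
    · simp [hc, Ne.symm hc]
  rw [Matrix.mul_apply, Fintype.sum_prod_type, Finset.sum_eq_single j
    (fun l _ hl => by simp [controlled_apply, hl.symm]) (by simp), Finset.sum_eq_single 0
    (fun l _ hl => by simp [h1, hl]) (by simp), h1, Matrix.conjTranspose_apply, controlled_apply]
  simp only [if_true]
  ring

/-- Entrywise multiplication by `C`, as a linear map. -/
def schurMultiplier (C : Matrix (Fin d) (Fin d) ℂ) :
    Matrix (Fin d) (Fin d) ℂ →ₗ[ℂ] Matrix (Fin d) (Fin d) ℂ where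
  toFun X := Matrix.of fun i j => C i j * X i j
  map_add' X Y := by ext i j; simp [mul_add]
  map_smul' c X := by ext i j; simp [mul_left_comm]

/-- Entrywise multiplication by a positive semidefinite matrix whose diagonal entries are at most
one is an energy-preserving operation. -/
theorem schurMultiplier_mem {C : Matrix (Fin d) (Fin d) ℂ} (hC : C.PosSemidef)
    (hdiag : ∀ i, (C i i).re ≤ 1) : schurMultiplier C ∈ energyPreservingOperations E := by
  obtain ⟨B, rfl⟩ := exists_eq_conjTranspose_mul_self hC
  have hB : ∀ i, ∑ a, ‖B a i‖ ^ 2 ≤ 1 := by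
    intro i
    refine le_of_eq_of_le ?_ (hdiag i)
    rw [← Complex.ofReal_re (∑ a, ‖B a i‖ ^ 2), Matrix.mul_apply]
    congr 1
    push_cast
    refine Finset.sum_congr rfl fun a _ => ?_
    rw [Matrix.conjTranspose_apply, RCLike.star_def, Complex.conj_mul']
  -- The conjugated `i`-th column of `B`, completed to a unit vector by a slack coordinate at index
  -- `0`.
  let v : Fin d → Fin (d + 1) → ℂ := fun i =>
    Fin.cons ((√(1 - ∑ a, ‖B a i‖ ^ 2) : ℝ) : ℂ) fun a => star (B a i)
  have hv : ∀ i, ∑ a, ‖v i a‖ ^ 2 = 1 := by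
    intro i
    rw [Fin.sum_univ_succ]
    simp only [v, Fin.cons_zero, Fin.cons_succ, norm_star, Complex.norm_real, Real.norm_eq_abs,
      sq_abs]
    rw [Real.sq_sqrt (sub_nonneg.2 (hB i))]
    ring
  choose V hV hVv using fun i => exists_unitary_first_column (v i) (hv i)
  -- The kept outcome projects away the slack, leaving the overlaps `∑ a, star (B a i) * B a j = C i
  -- j`.
  let μ : Fin (d + 1) → ℂ := Fin.cons 0 1
  refine ⟨d + 1, 0, Matrix.single 0 0 1, controlled V, 2,
    ![Matrix.diagonal μ, Matrix.diagonal (1 - μ)], {0}, ⟨?_, by simp⟩,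
    controlled_mem_unitaryGroup hV, controlled_mul_totalHamiltonian V E 0, ?_, ?_, fun X => ?_⟩
  · rw [← Matrix.diagonal_single]
    exact .diagonal (by simp)
  · have h0 : 0 ≤ μ := fun a => by
      refine Fin.cases ?_ (fun a => ?_) a <;> simp [μ]
    have h1 : 0 ≤ 1 - μ := fun a => by
      refine Fin.cases ?_ (fun a => ?_) a <;> simp [μ]
    exact Fin.forall_fin_two.2 ⟨.diagonal h0, .diagonal h1⟩
  · simp [Fin.sum_univ_two]
  · ext i j
    rw [Finset.sum_singleton]
    simp only [schurMultiplier, LinearMap.coe_mk, AddHom.coe_mk, Matrix.of_apply,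
      partialTraceRight, Matrix.cons_val_zero]
    have hentry : ∀ a, (((1 : Matrix (Fin d) (Fin d) ℂ) ⊗ₖ Matrix.diagonal μ) *
        (controlled V * (X ⊗ₖ Matrix.single 0 0 1) * (controlled V)ᴴ) :
        Matrix (Fin d × Fin (d + 1)) (Fin d × Fin (d + 1)) ℂ) (i, a) (j, a) =
        μ a * (X i j * (v i a * star (v j a))) := by
      intro a
      rw [← Matrix.diagonal_one, Matrix.diagonal_kronecker_diagonal, Matrix.diagonal_mul,
        controlled_conj_apply, hVv, hVv, one_mul]
    simp only [hentry, Fin.sum_univ_succ]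
    simp only [μ, v, Fin.cons_zero, Fin.cons_succ, zero_mul, zero_add, Pi.one_apply, one_mul,
      star_star, Matrix.mul_apply, Matrix.conjTranspose_apply, ← Finset.mul_sum]
    rw [mul_comm]

end Operations

end Activity

namespace Activity

/-! ### The advantage: attainment and the two bounds -/

section Advantage

variable {d : ℕ} (E : Fin d → ℝ) {ρ : Matrix (Fin d) (Fin d) ℂ}

theorem coherentFidelity_schurMultiplier (C X : Matrix (Fin d) (Fin d) ℂ) :
    coherentFidelity (schurMultiplier C X) = (d : ℝ)⁻¹ * (∑ i, ∑ j, C i j * X i j).re :=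
  coherentFidelity_eq_sum _

/-- The minimum over passive states in the definition of the advantage is attained. -/
theorem isLeast_fidelityRatio (hρ : IsState ρ)
    (Q : Matrix (Fin d) (Fin d) ℂ →ₗ[ℂ] Matrix (Fin d) (Fin d) ℂ) :
    IsLeast ((fun τ => fidelityRatio Q ρ τ) '' passiveStates E) (advantage E ρ Q) := by
  have hcont : Continuous fun τ => fidelityRatio Q ρ τ := by
    simp only [fidelityRatio, div_eq_mul_inv]
    -- Inversion is continuous on all of `[0, ∞]` and the numerator is finite, so vanishing
    -- denominators need no separate treatment.
    refine (ENNReal.continuous_const_mul ENNReal.ofReal_ne_top).comp (continuous_inv.comp ?_)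
    exact ENNReal.continuous_ofReal.comp (continuous_coherentFidelity.comp
      (LinearMap.continuous_of_finiteDimensional Q))
  obtain ⟨τ, hτ, hmin⟩ := (isCompact_passiveStates E).exists_isMinOn
    ⟨_, maximallyMixed_mem_passiveStates E hρ.dim_ne_zero⟩ hcont.continuousOn
  have hval : advantage E ρ Q = fidelityRatio Q ρ τ :=
    le_antisymm (iInf₂_le τ hτ) (le_iInf₂ fun τ' hτ' => hmin hτ')
  rw [hval]
  exact ⟨⟨τ, hτ, rfl⟩, by rintro _ ⟨τ', hτ', rfl⟩; exact hmin hτ'⟩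

/-- If `ρ ≤ r τ` for a passive `τ`, then no energy-preserving operation has advantage above `r`. -/
theorem advantage_le {Q : Matrix (Fin d) (Fin d) ℂ →ₗ[ℂ] Matrix (Fin d) (Fin d) ℂ}
    (hQ : Q ∈ energyPreservingOperations E) {τ : Matrix (Fin d) (Fin d) ℂ}
    (hτ : τ ∈ passiveStates E) {r : ℝ} (hr : 0 ≤ r) (h : (r • τ - ρ).PosSemidef) :
    advantage E ρ Q ≤ ENNReal.ofReal r := by
  refine (iInf₂_le τ hτ).trans (ENNReal.div_le_of_le_mul ?_)
  rw [← ENNReal.ofReal_mul hr]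
  refine ENNReal.ofReal_le_ofReal ?_
  have h0 := coherentFidelity_nonneg_of_mem hQ h
  have hQr : Q (r • τ) = r • Q τ := LinearMap.map_smul_of_tower Q r τ
  rw [map_sub, hQr, coherentFidelity_sub, coherentFidelity_smul] at h0
  linarith

/-- An energy-preserving operation that reaches the optimal advantage. -/
theorem exists_le_advantage (hρ : IsState ρ) (s : ℝ≥0)
    (hs : ∀ (t : ℝ≥0), ∀ τ ∈ passiveStates E, ((2 : ℝ) ^ (t : ℝ) • τ - ρ).PosSemidef → s ≤ t) :
    ∃ Q ∈ energyPreservingOperations E,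
      ENNReal.ofReal ((2 : ℝ) ^ (s : ℝ)) ≤ advantage E ρ Q := by
  obtain ⟨C, hC, hCρ, hCτ⟩ := exists_dual_certificate E hρ s hs
  have hd : (0 : ℝ) < (d : ℝ)⁻¹ :=
    inv_pos.2 (Nat.cast_pos.2 (Nat.pos_of_ne_zero hρ.dim_ne_zero))
  have hdiag : ∀ i, 0 ≤ (C i i).re := fun i => (Complex.nonneg_iff.1 hC.diag_nonneg).1
  -- Dividing by `c` brings the diagonal below one; the fidelity ratio is insensitive to this
  -- scaling.
  set c : ℝ := 1 + ∑ i, (C i i).re with hc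
  have hc0 : 0 < c := by
    have := Finset.sum_nonneg fun i (_ : i ∈ Finset.univ) => hdiag i
    linarith
  have hval : ∀ X : Matrix (Fin d) (Fin d) ℂ, coherentFidelity (schurMultiplier (c⁻¹ • C) X) =
      (d : ℝ)⁻¹ * c⁻¹ * (∑ i, ∑ j, C i j * X i j).re := by
    intro X
    rw [coherentFidelity_schurMultiplier, mul_assoc]
    simp only [Matrix.smul_apply, smul_mul_assoc, ← Finset.smul_sum, Complex.smul_re, smul_eq_mul]
  refine ⟨schurMultiplier (c⁻¹ • C), schurMultiplier_mem (hC.smul (inv_nonneg.2 hc0.le))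
    fun i => ?_, le_iInf₂ fun τ hτ => ?_⟩
  · rw [Matrix.smul_apply, Complex.smul_re, smul_eq_mul, inv_mul_le_one₀ hc0]
    have := Finset.single_le_sum (f := fun i => (C i i).re) (fun i _ => hdiag i)
      (Finset.mem_univ i)
    linarith
  · have hdc : 0 < (d : ℝ)⁻¹ * c⁻¹ := mul_pos hd (inv_pos.2 hc0)
    -- Strict positivity of the numerator excludes `0 / 0`, which counts as `0`; a zero denominator
    -- then gives `∞`.
    rw [fidelityRatio, hval, hval, ENNReal.le_div_iff_mul_le
      (.inr (ENNReal.ofReal_pos.2 (mul_pos hdc hCρ)).ne') (.inl ENNReal.ofReal_ne_top),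
      ← ENNReal.ofReal_mul (by positivity)]
    refine ENNReal.ofReal_le_ofReal ?_
    rw [mul_left_comm]
    exact mul_le_mul_of_nonneg_left (hCτ τ hτ) hdc.le

end Advantage

end Activity

/-- The first two conjuncts say that the minimum in the definition of `R` is finite and attained, the
third that the minimum over passive states is attained for every operation, and the last is the
equality, with an attained maximum. -/
theorem mainTheorem3 {d : ℕ} (E : Fin d → ℝ) (hE : StrictMono E)
    (ρ : Matrix (Fin d) (Fin d) ℂ) (hρ : Activity.IsState ρ) :
    Activity.maxRelEntropyOfActivity E ρ ≠ ∞ ∧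
    IsLeast ((fun τ => Activity.maxRelEntropy ρ τ) '' Activity.passiveStates E)
      (Activity.maxRelEntropyOfActivity E ρ) ∧
    (∀ Q ∈ Activity.energyPreservingOperations E,
      IsLeast ((fun τ => Activity.fidelityRatio Q ρ τ) '' Activity.passiveStates E)
        (Activity.advantage E ρ Q)) ∧
    IsGreatest (Activity.advantage E ρ '' Activity.energyPreservingOperations E)
      ((2 : ℝ≥0∞) ^ (Activity.maxRelEntropyOfActivity E ρ).toReal) := by
  obtain ⟨s, τ, hτ, hP, hmin⟩ := Activity.exists_minimal_dilation E hρ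
  have hge : ∀ τ' ∈ Activity.passiveStates E, (s : ℝ≥0∞) ≤ Activity.maxRelEntropy ρ τ' :=
    fun τ' hτ' => le_iInf₂ fun t ht => ENNReal.coe_le_coe.2 (hmin t τ' hτ' ht)
  have hle : Activity.maxRelEntropy ρ τ ≤ s := iInf₂_le s hP
  have hR : Activity.maxRelEntropyOfActivity E ρ = s :=
    le_antisymm ((iInf₂_le τ hτ).trans hle) (le_iInf₂ hge)
  have hpow : (2 : ℝ≥0∞) ^ (s : ℝ) = ENNReal.ofReal ((2 : ℝ) ^ (s : ℝ)) := by
    rw [← ENNReal.ofReal_rpow_of_pos two_pos, ENNReal.ofReal_ofNat]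
  rw [hR]
  refine ⟨ENNReal.coe_ne_top, ⟨⟨τ, hτ, le_antisymm hle (hge τ hτ)⟩, ?_⟩,
    fun Q _ => Activity.isLeast_fidelityRatio E hρ Q, ?_⟩
  · rintro _ ⟨τ', hτ', rfl⟩
    exact hge τ' hτ'
  · rw [ENNReal.coe_toReal, hpow]
    have hub : ∀ Q ∈ Activity.energyPreservingOperations E,
        Activity.advantage E ρ Q ≤ ENNReal.ofReal ((2 : ℝ) ^ (s : ℝ)) :=
      fun Q hQ => Activity.advantage_le E hQ hτ (by positivity) hP
    obtain ⟨Q, hQ, hQs⟩ := Activity.exists_le_advantage E hρ s hmin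
    exact ⟨⟨Q, hQ, le_antisymm (hub Q hQ) hQs⟩, by rintro _ ⟨Q', hQ', rfl⟩; exact hub Q' hQ'⟩
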